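/- Let $\mathbb K$ be a field. For a submonoid $S\subseteq\mathbb N$ with $\mathbb N\setminus S$ finite, let $a_0<a_1<\dots<a_p$ be its minimal generators, let $\operatorname{wd}(S)=a_p-a_0$ be its width, let $I_S$ be the kernel of the $\mathbb K$-algebra homomorphism $\mathbb K[x_0,\dots,x_p]\to\mathbb K[t]$, $x_i\mapsto t^{a_i}$, and let $\mu(I_S)$ be the minimal number of generators of the ideal $I_S$. For integers $e\ge 10$ and $2\le n\le e-2$, let $S(e,1,n)$ be the submonoid of $\mathbb N$ generated by $\{e,e+1,\dots,2e-1\}\setminus\{e+1,e+n\}$. Then $$\mu(I_{S(e,1,n)})=\begin{cases}\binom{e-2}{2}-1 & \text{if } n=4,\\ \binom{e-2}{2}-2 & \text{otherwise.}\end{cases}$$ In particular, $\mu(I_{S})\le\binom{\operatorname{wd}(S)+1}{2}$ for $S=S(e,1,n)$. -/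

import Mathlib

noncomputable section

/-- The minimal generators of a submonoid `S` of `ℕ`: the nonzero elements of `S` that are not a
sum of two nonzero elements of `S`. -/
def minimalGenerators (S : AddSubmonoid ℕ) : Set ℕ :=
  {a | a ∈ S ∧ a ≠ 0 ∧ ∀ b ∈ S, ∀ c ∈ S, a = b + c → b = 0 ∨ c = 0}

/-- `minimalGenerators S` is the unique minimal generating set of `S`: it generates `S` and is
contained in every generating set. -/
theorem isLeast_minimalGenerators (S : AddSubmonoid ℕ) :
    IsLeast {A : Set ℕ | AddSubmonoid.closure A = S} (minimalGenerators S) := by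
  constructor
  · apply le_antisymm
    · exact (AddSubmonoid.closure_le).2 fun a ha => ha.1
    · intro a
      induction a using Nat.strong_induction_on with
      | _ a ih =>
        intro ha
        by_cases h0 : a = 0
        · rw [h0]; exact zero_mem _
        by_cases hm : a ∈ minimalGenerators S
        · exact AddSubmonoid.subset_closure hm
        · have : ∃ b ∈ S, ∃ c ∈ S, a = b + c ∧ b ≠ 0 ∧ c ≠ 0 := by
            by_contra hcon
            refine hm ⟨ha, h0, fun b hb c hc h => ?_⟩
            by_contra h2
            rw [not_or] at h2
            exact hcon ⟨b, hb, c, hc, h, h2.1, h2.2⟩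
          obtain ⟨b, hb, c, hc, h, hb0, hc0⟩ := this
          rw [h]
          exact add_mem (ih b (by omega) hb) (ih c (by omega) hc)
  · rintro A rfl a ⟨ha, ha0, hirr⟩
    have key : ∀ x ∈ AddSubmonoid.closure A, x ∈ A ∨ x = 0 ∨
        ∃ b ∈ AddSubmonoid.closure A, ∃ c ∈ AddSubmonoid.closure A,
          x = b + c ∧ b ≠ 0 ∧ c ≠ 0 := by
      intro x hx
      induction hx using AddSubmonoid.closure_induction with
      | mem x hx => exact Or.inl hx
      | zero => exact Or.inr (Or.inl rfl)
      | add x y hx hy ihx ihy =>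
        by_cases hx0 : x = 0
        · subst hx0; simpa using ihy
        by_cases hy0 : y = 0
        · subst hy0; simpa using ihx
        exact Or.inr (Or.inr ⟨x, hx, y, hy, rfl, hx0, hy0⟩)
    rcases key a ha with h | h | ⟨b, hb, c, hc, h, hb0, hc0⟩
    · exact h
    · exact absurd h ha0
    · rcases hirr b hb c hc h with h | h
      · exact absurd h hb0
      · exact absurd h hc0

/-- The width of a numerical semigroup: its largest minus its smallest minimal generator. -/
def semigroupWidth (S : AddSubmonoid ℕ) : ℕ :=
  sSup (minimalGenerators S) - sInf (minimalGenerators S)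

/-- The defining ideal `I_S`: the kernel of the `K`-algebra homomorphism that sends `x_a` to `t ^ a`,
with one variable `x_a` for each minimal generator `a` of `S`. (The image is `K[S]`, a subalgebra
of `K[t]`.) -/
def definingIdeal (K : Type*) [Field K] (S : AddSubmonoid ℕ) :
    Ideal (MvPolynomial (minimalGenerators S) K) :=
  RingHom.ker (MvPolynomial.aeval (R := K)
    (fun a : minimalGenerators S => (Polynomial.X : Polynomial K) ^ (a : ℕ)))

/-- `S(e,m,n)`, the submonoid of `ℕ` generated by `{e, e+1, …, 2e-1} \ {e+m, e+n}`. -/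
def sallyTypeSemigroup (e m n : ℕ) : AddSubmonoid ℕ :=
  AddSubmonoid.closure (Set.Icc e (2 * e - 1) \ {e + m, e + n})

end

/-!
The toric ideal `I_S` is spanned by differences of monomials of equal weight, where the variable
`x_a` has weight `a`. Modulo the nonzerodivisor `t ^ e`, the ring `K[S]` has a basis indexed by the
Apéry set of `S = S(e,1,n)`: `0`, the generators other than `e`, and two "special" elements, `3e+1`
and either `2e+n` (if `n ≥ 4`) or `3e+n` (if `n ≤ 3`). Both are sums of two generators other
than `e`. Hence a quadratic monomial `x_a x_b` with `a, b > e` either has special weight or the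
weight of a monomial divisible by `x_e`. Apart from one monomial for each special weight, each of
the `(e-2).choose 2` such quadratic monomials gives one binomial of the ideal.

These binomials generate as soon as every monomial with three or more factors is congruent to a
multiple of `x_e`, by induction on the weight (`IsSallyWeight.congr_of_weight_eq`). For a cubic
monomial with all pairs special two variables coincide, so it is `x_a x_b ^ 2`; rewriting `x_b ^ 2`
as another product `x_i x_j` of the same weight produces a non-special pair
(`IsSallyWeight.exists_congr_var_add_of_sq`). The only special square without another factorization
is `x_{e+2} ^ 2` for `n = 4`, and then `x_{e+2} ^ 3` requires one more binomial.

Minimality (`spanRank_toricIdeal`) comes from the coefficients of these quadratic monomials and of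
`x_{e+2} ^ 3`: a proper divisor of such a monomial is the only monomial of its weight, hence does
not occur in the ideal, so these coefficients vanish on the product of `I_S` with the ideal of the
variables, and they separate the chosen binomials.
-/

/-! ### Minimal generators of toric ideals -/

open MvPolynomial in
/-- The toric ideal of a weight function `w`: the kernel of `x_i ↦ t ^ w i`. -/
noncomputable def toricIdeal (K : Type*) [Field K] {σ : Type*} (w : σ → ℕ) :
    Ideal (MvPolynomial σ K) :=
  RingHom.ker (aeval (R := K) fun i => (Polynomial.X : Polynomial K) ^ w i)

section Toric

open MvPolynomial

variable {K : Type*} [Field K] {σ : Type*} {w : σ → ℕ}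

theorem aeval_X_pow_monomial (w : σ → ℕ) (u : σ →₀ ℕ) (c : K) :
    aeval (fun i => (Polynomial.X : Polynomial K) ^ w i) (monomial u c) =
      Polynomial.monomial (Finsupp.weight w u) c := by
  rw [aeval_monomial, ← Polynomial.C_mul_X_pow_eq_monomial, Finsupp.weight_apply, Finsupp.prod,
    Finsupp.sum, ← Finset.prod_pow_eq_pow_sum]
  simp [← pow_mul, mul_comm]

theorem binomial_mem_toricIdeal {u v : σ →₀ ℕ} (h : Finsupp.weight w u = Finsupp.weight w v) :
    monomial u (1 : K) - monomial v 1 ∈ toricIdeal K w := by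
  rw [toricIdeal, RingHom.mem_ker, map_sub, aeval_X_pow_monomial, aeval_X_pow_monomial, h, sub_self]

/-- An ideal containing all binomials of equal weight contains the toric ideal: modulo such an
ideal, a polynomial is determined by its image in `K[t]`. -/
theorem toricIdeal_le_of_binomial_mem {L : Ideal (MvPolynomial σ K)}
    (h : ∀ u v : σ →₀ ℕ, Finsupp.weight w u = Finsupp.weight w v →
      monomial u (1 : K) - monomial v 1 ∈ L) :
    toricIdeal K w ≤ L := by
  classical
  -- a linear section sending `t ^ d` to one chosen monomial of weight `d`
  let r : ℕ → σ →₀ ℕ := Function.invFun (Finsupp.weight w)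
  let ρ : Polynomial K →ₗ[K] MvPolynomial σ K :=
    Polynomial.lsum fun d => MvPolynomial.monomial (r d)
  have hρ : ∀ d c, ρ (Polynomial.monomial d c) = monomial (r d) c := fun d c => by
    simp only [ρ, Polynomial.lsum_apply]
    rw [Polynomial.sum_monomial_index _ _ (by simp)]
  have key : ∀ f : MvPolynomial σ K,
      f - ρ (aeval (fun i => (Polynomial.X : Polynomial K) ^ w i) f) ∈ L := by
    intro f
    induction f using MvPolynomial.induction_on' with
    | monomial u c =>
      rw [aeval_X_pow_monomial, hρ]
      have := L.mul_mem_left (C c) (h u (r (Finsupp.weight w u))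
        (Function.invFun_eq (f := Finsupp.weight w) ⟨u, rfl⟩).symm)
      simpa [mul_sub, C_mul_monomial] using this
    | add p q hp hq =>
      rw [map_add, map_add, add_sub_add_comm]
      exact L.add_mem hp hq
  intro f hf
  have hf0 : aeval (fun i => (Polynomial.X : Polynomial K) ^ w i) f = 0 := hf
  simpa [hf0] using key f

/-- A monomial that is the only one of its weight does not occur in the toric ideal. -/
theorem coeff_eq_zero_of_mem_toricIdeal {f : MvPolynomial σ K} (hf : f ∈ toricIdeal K w)
    {u : σ →₀ ℕ} (hu : ∀ v, Finsupp.weight w v = Finsupp.weight w u → v = u) :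
    coeff u f = 0 := by
  classical
  have key : ∀ g : MvPolynomial σ K, coeff u g =
      (aeval (fun i => (Polynomial.X : Polynomial K) ^ w i) g).coeff (Finsupp.weight w u) := by
    intro g
    induction g using MvPolynomial.induction_on' with
    | monomial v c =>
      rw [aeval_X_pow_monomial, Polynomial.coeff_monomial, coeff_monomial]
      by_cases hv : v = u
      · simp [hv]
      · rw [if_neg hv, if_neg fun h => hv (hu v h)]
    | add p q hp hq => simp [hp, hq]
  have hf0 : aeval (fun i => (Polynomial.X : Polynomial K) ^ w i) f = 0 := hf
  rw [key, hf0, Polynomial.coeff_zero]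

/-- The congruence on exponents given by equality of monomials modulo an ideal. -/
def binomialCon (L : Ideal (MvPolynomial σ K)) : AddCon (σ →₀ ℕ) where
  r u v := monomial u (1 : K) - monomial v 1 ∈ L
  iseqv :=
    { refl := fun u => by simp
      symm := fun {u v} h => by simpa using L.neg_mem h
      trans := fun {u v t} h h' => by simpa using L.add_mem h h' }
  add' := fun {u v s t} h h' => by
    have := L.add_mem (L.mul_mem_right (monomial s (1 : K)) h) (L.mul_mem_left (monomial v 1) h')
    simpa [sub_mul, mul_sub, monomial_mul] using this

/-- A criterion for the number of generators of a toric ideal. The binomials `x ^ m - x ^ nf m`,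
`m ∈ T`, generate it by `hgen`. By `hiso` the proper divisors of each `m ∈ T` do not occur in the
ideal, so extracting the coefficient of `x ^ m` kills the product of the ideal with the ideal of the
variables; the binomials are therefore linearly independent modulo that product. -/
theorem spanRank_toricIdeal (T : Finset (σ →₀ ℕ)) (nf : (σ →₀ ℕ) → σ →₀ ℕ)
    (hnf : ∀ m ∈ T, nf m ∉ T)
    (hweight : ∀ m ∈ T, Finsupp.weight w (nf m) = Finsupp.weight w m)
    (hiso : ∀ m ∈ T, ∀ u v, u + v = m → u ≠ 0 →
      ∀ v', Finsupp.weight w v' = Finsupp.weight w v → v' = v)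
    (hgen : ∀ u v, Finsupp.weight w u = Finsupp.weight w v →
      addConGen (fun m m' => m ∈ T ∧ m' = nf m) u v) :
    (toricIdeal K w).spanRank = (T.card : Cardinal) := by
  classical
  let b : (σ →₀ ℕ) → MvPolynomial σ K := fun m => monomial m 1 - monomial (nf m) 1
  have hb : ∀ m ∈ T, b m ∈ toricIdeal K w := fun m hm =>
    binomial_mem_toricIdeal (hweight m hm).symm
  have hspan : Ideal.span (b '' T) = toricIdeal K w := by
    apply le_antisymm
    · rw [Ideal.span_le]
      rintro _ ⟨m, hm, rfl⟩
      exact hb m hm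
    · refine toricIdeal_le_of_binomial_mem fun u v huv => ?_
      have hle : addConGen (fun m m' => m ∈ T ∧ m' = nf m) ≤
          binomialCon (Ideal.span (b '' T)) := by
        rw [AddCon.addConGen_le]
        rintro m _ ⟨hm, rfl⟩
        exact Ideal.subset_span ⟨m, hm, rfl⟩
      exact hle (hgen u v huv)
  apply le_antisymm
  · rw [← hspan]
    refine (Submodule.spanRank_span_le_card _).trans ?_
    rw [← Finset.coe_image]
    refine (Cardinal.mk_coe_finset (s := T.image b)).trans_le ?_
    exact_mod_cast Finset.card_image_le
  · obtain ⟨G, hG, hGspan⟩ := Submodule.exists_span_set_card_eq_spanRank (toricIdeal K w)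
    rw [← hG]
    let φ : MvPolynomial σ K →ₗ[K] (T → K) := LinearMap.pi fun m => lcoeff K m.1
    have hφ : ∀ g f : MvPolynomial σ K, f ∈ toricIdeal K w →
        φ (g * f) = coeff 0 g • φ f := by
      intro g f hf
      ext m
      change coeff m.1 (g * f) = coeff 0 g * coeff m.1 f
      rw [coeff_mul, Finset.sum_eq_single (0, m.1)]
      · rintro ⟨u, v⟩ huv hne
        rw [Finset.HasAntidiagonal.mem_antidiagonal] at huv
        have hu : u ≠ 0 := by
          rintro rfl
          exact hne (by simpa using huv)
        rw [coeff_eq_zero_of_mem_toricIdeal hf (hiso m.1 m.2 u v huv hu), mul_zero]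
      · simp
    have hmem : ∀ f ∈ Submodule.span (MvPolynomial σ K) G, φ f ∈ Submodule.span K (φ '' G) := by
      intro f hf
      induction hf using Submodule.span_induction with
      | mem x hx => exact Submodule.subset_span ⟨x, hx, rfl⟩
      | zero => simp
      | add x y _ _ hx hy => rw [map_add]; exact Submodule.add_mem _ hx hy
      | smul a x hx h =>
        rw [smul_eq_mul, hφ a x (hGspan ▸ hx)]
        exact Submodule.smul_mem _ _ h
    have htop : Submodule.span K (φ '' G) = ⊤ := by
      rw [eq_top_iff, ← (Pi.basisFun K T).span_eq, Submodule.span_le]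
      rintro _ ⟨m, rfl⟩
      have h1 : φ (b m.1) = Pi.basisFun K T m := by
        ext m'
        have h2 : nf m.1 ≠ m'.1 := fun h => hnf m.1 m.2 (h ▸ m'.2)
        change coeff m'.1 (monomial m.1 (1 : K) - monomial (nf m.1) 1) = _
        rw [coeff_sub, coeff_monomial, coeff_monomial, if_neg h2, Pi.basisFun_apply,
          Pi.single_apply, sub_zero]
        simp only [Subtype.ext_iff, eq_comm]
      rw [← h1]
      exact hmem _ (hGspan ▸ hb m.1 m.2)
    have hr : Module.rank K (T → K) = (T.card : Cardinal) := by simp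
    rw [← hr, ← rank_top K (T → K), ← htop]
    exact (rank_span_le _).trans Cardinal.mk_image_le

end Toric

/-! ### Exponent vectors for the weights of `S(e,1,n)` -/

section SallyWeights

open Finsupp

variable {σ : Type*} {w : σ → ℕ} {e n : ℕ}

/-- The variables indexed by `σ` correspond, through their weights `w`, to the generators
`{e, …, 2e-1} \ {e+1, e+n}` of `S(e,1,n)`, where `e ≥ 10` and `2 ≤ n ≤ e - 2`. -/
structure IsSallyWeight (w : σ → ℕ) (e n : ℕ) : Prop where
  ten_le : 10 ≤ e
  two_le : 2 ≤ n
  le_sub : n ≤ e - 2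
  inj : Function.Injective w
  range : ∀ a, (∃ i, w i = a) ↔ e ≤ a ∧ a < 2 * e ∧ a ≠ e + 1 ∧ a ≠ e + n

/-- `d` is one of the two elements of the Apéry set of `S(e,1,n)` with respect to `e` that are
neither `0` nor a generator: the least elements of the residue classes of `1` and `n`. -/
def IsSpecial (e n d : ℕ) : Prop :=
  d = 3 * e + 1 ∨ n < 4 ∧ d = 3 * e + n ∨ 4 ≤ n ∧ d = 2 * e + n

theorem weight_var (w : σ → ℕ) (a : σ) : Finsupp.weight w (single a 1) = w a := by
  simp [Finsupp.weight_single]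

theorem exists_eq_var_add (u : σ →₀ ℕ) : u = 0 ∨ ∃ a v, u = single a 1 + v := by
  by_cases hu : u = 0
  · exact Or.inl hu
  · obtain ⟨a, ha⟩ := Finsupp.ne_iff.1 hu
    refine Or.inr ⟨a, u - single a 1, (add_tsub_cancel_of_le ?_).symm⟩
    simpa [Nat.one_le_iff_ne_zero] using ha

theorem exponent_cases (u : σ →₀ ℕ) : u = 0 ∨ (∃ a, u = single a 1) ∨
    (∃ a b, u = single a 1 + single b 1) ∨
    ∃ a b c v, u = single a 1 + single b 1 + single c 1 + v := by
  obtain rfl | ⟨a, u, rfl⟩ := exists_eq_var_add u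
  · exact Or.inl rfl
  obtain rfl | ⟨b, u, rfl⟩ := exists_eq_var_add u
  · exact Or.inr (Or.inl ⟨a, by simp⟩)
  obtain rfl | ⟨c, u, rfl⟩ := exists_eq_var_add u
  · exact Or.inr (Or.inr (Or.inl ⟨a, b, by simp⟩))
  · exact Or.inr (Or.inr (Or.inr ⟨a, b, c, u, by simp only [add_assoc]⟩))

namespace IsSallyWeight

variable (h : IsSallyWeight w e n)
include h

theorem bounds (a : σ) : e ≤ w a ∧ w a < 2 * e ∧ w a ≠ e + 1 ∧ w a ≠ e + n :=
  (h.range _).1 ⟨a, rfl⟩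

theorem exists_var {a : ℕ} (h1 : e ≤ a) (h2 : a < 2 * e) (h3 : a ≠ e + 1) (h4 : a ≠ e + n) :
    ∃ i, w i = a :=
  (h.range _).2 ⟨h1, h2, h3, h4⟩

theorem eq_zero_of_weight {v : σ →₀ ℕ} (hv : Finsupp.weight w v = 0) : v = 0 := by
  have := h.ten_le
  obtain rfl | ⟨a, u, rfl⟩ := exists_eq_var_add v
  · rfl
  · have := h.bounds a
    rw [map_add, weight_var] at hv
    omega

theorem eq_var_of_weight {v : σ →₀ ℕ} {a : σ} (hv : Finsupp.weight w v = w a) :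
    v = single a 1 := by
  have := h.ten_le
  have ha := h.bounds a
  obtain rfl | ⟨b, rfl⟩ | ⟨b, c, rfl⟩ | ⟨b, c, d, u, rfl⟩ := exponent_cases v
  · simp only [map_zero] at hv
    omega
  · rw [weight_var] at hv
    rw [h.inj hv]
  · have hb := h.bounds b
    have hc := h.bounds c
    simp only [map_add, weight_var] at hv
    omega
  · have hb := h.bounds b
    have hc := h.bounds c
    simp only [map_add, weight_var] at hv
    omega

/-- For `n = 4` neither `x_{e+1} x_{e+3}` nor `x_e x_{e+4}` exists, so `x_{e+2} ^ 2` is the only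
monomial of its weight. -/
theorem eq_sq_of_weight (hn : n = 4) {v : σ →₀ ℕ} {a : σ} (ha : w a = e + 2)
    (hv : Finsupp.weight w v = w a + w a) : v = single a 1 + single a 1 := by
  have := h.ten_le
  obtain rfl | ⟨b, rfl⟩ | ⟨b, c, rfl⟩ | ⟨b, c, d, u, rfl⟩ := exponent_cases v
  · simp only [map_zero] at hv
    omega
  · have hb := h.bounds b
    rw [weight_var] at hv
    omega
  · have hb := h.bounds b
    have hc := h.bounds c
    simp only [map_add, weight_var] at hv
    have h1 : b = a := h.inj (by omega)
    have h2 : c = a := h.inj (by omega)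
    rw [h1, h2]
  · have hb := h.bounds b
    have hc := h.bounds c
    have hd := h.bounds d
    simp only [map_add, weight_var] at hv
    omega

/-- Subtracting `e` from a special weight leaves the semigroup. -/
theorem not_isSpecial_add (u : σ →₀ ℕ) : ¬ IsSpecial e n (e + Finsupp.weight w u) := by
  have := h.ten_le
  have := h.two_le
  have := h.le_sub
  unfold IsSpecial
  obtain rfl | ⟨b, rfl⟩ | ⟨b, c, rfl⟩ | ⟨b, c, d, u, rfl⟩ := exponent_cases u
  · simp only [map_zero]
    omega
  · have hb := h.bounds b
    rw [weight_var]
    omega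
  · have hb := h.bounds b
    have hc := h.bounds c
    simp only [map_add, weight_var]
    omega
  · have hb := h.bounds b
    have hc := h.bounds c
    have hd := h.bounds d
    simp only [map_add, weight_var]
    omega

theorem exists_pair_of_isSpecial {d : ℕ} (hd : IsSpecial e n d) :
    ∃ i j, e < w i ∧ e < w j ∧ w i + w j = d ∧ (d ≠ 2 * e + 4 → w i ≠ w j) := by
  have := h.ten_le
  have := h.two_le
  have := h.le_sub
  have pair : ∀ a b, a + b = d → e + 2 ≤ a → a ≠ e + n → e + 2 ≤ b → b < 2 * e → b ≠ e + n →
      a < 2 * e → (d ≠ 2 * e + 4 → a ≠ b) →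
      ∃ i j, e < w i ∧ e < w j ∧ w i + w j = d ∧ (d ≠ 2 * e + 4 → w i ≠ w j) := by
    intro a b hab ha ha' hb hb' hb'' ha'' hne
    obtain ⟨i, rfl⟩ := h.exists_var (a := a) (by omega) (by omega) (by omega) (by omega)
    obtain ⟨j, rfl⟩ := h.exists_var (a := b) (by omega) (by omega) (by omega) (by omega)
    exact ⟨i, j, by omega, by omega, hab, hne⟩
  rcases hd with rfl | ⟨hn, rfl⟩ | ⟨hn, rfl⟩
  · by_cases h2 : n = 2
    · apply pair (e + 3) (2 * e - 2) <;> omega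
    · apply pair (e + 2) (2 * e - 1) <;> omega
  · apply pair (e + n + 1) (2 * e - 1) <;> omega
  · apply pair (e + 2) (e + n - 2) <;> omega

/-- Every non-special weight of a quadratic monomial is the weight of a monomial divisible by the
variable of weight `e`. -/
theorem exists_weight_add_eq {d : ℕ} (h1 : 2 * e + 4 ≤ d) (h2 : d < 4 * e)
    (hd : ¬ IsSpecial e n d) : ∃ u : σ →₀ ℕ, e + Finsupp.weight w u = d := by
  have := h.ten_le
  have := h.two_le
  have := h.le_sub
  obtain ⟨z, hz⟩ := h.exists_var (a := e) (by omega) (by omega) (by omega) (by omega)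
  unfold IsSpecial at hd
  by_cases hs : d < 3 * e
  · obtain ⟨i, hi⟩ := h.exists_var (a := d - e) (by omega) (by omega) (by omega) (by omega)
    exact ⟨single i 1, by rw [weight_var]; omega⟩
  by_cases hn : d = 3 * e + n
  · obtain ⟨i, j, -, -, hij, -⟩ := h.exists_pair_of_isSpecial (d := 2 * e + n)
      (Or.inr (Or.inr ⟨by omega, rfl⟩))
    exact ⟨single i 1 + single j 1, by simp only [map_add, weight_var]; omega⟩
  · obtain ⟨i, hi⟩ := h.exists_var (a := d - 2 * e) (by omega) (by omega) (by omega) (by omega)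
    exact ⟨single z 1 + single i 1, by simp only [map_add, weight_var]; omega⟩

/-! ### Congruences identifying all exponents of equal weight -/

section Congruence

variable {c : AddCon (σ →₀ ℕ)} {z : σ}
  (h2 : ∀ a b, e < w a → e < w b → ¬ IsSpecial e n (w a + w b) →
    ∃ v, c (single a 1 + single b 1) (single z 1 + v))
  (hs : ∀ a b i j, e < w a → e < w b → e < w i → e < w j → IsSpecial e n (w a + w b) →
    w i + w j = w a + w b → c (single a 1 + single b 1) (single i 1 + single j 1))
  (h3 : n = 4 → ∀ a, w a = e + 2 →
    ∃ v, c (single a 1 + single a 1 + single a 1) (single z 1 + v))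

omit h in
theorem _root_.AddCon.exists_var_add_left {c : AddCon (σ →₀ ℕ)} {z : σ} {u : σ →₀ ℕ}
    (hu : ∃ v, c u (single z 1 + v)) (t : σ →₀ ℕ) : ∃ v, c (t + u) (single z 1 + v) := by
  obtain ⟨v, hv⟩ := hu
  exact ⟨t + v, by simpa only [add_left_comm] using c.add (c.refl t) hv⟩

include h2 hs h3 in
/-- The cubic `x_a x_b ^ 2`. If all its quadratic divisors are special, another factorization
`x_i x_j` of `x_b ^ 2` makes `x_a x_i` or `x_a x_j` non-special, unless `x_b ^ 2` has none. -/
theorem exists_congr_var_add_of_sq {a b : σ} (ha : e < w a) (hb : e < w b) :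
    ∃ v, c (single a 1 + (single b 1 + single b 1)) (single z 1 + v) := by
  have := h.ten_le
  have := h.two_le
  have := h.le_sub
  by_cases sab : IsSpecial e n (w a + w b)
  swap
  · have := AddCon.exists_var_add_left (h2 a b ha hb sab) (single b 1)
    rwa [← add_assoc, add_comm]
  by_cases sbb : IsSpecial e n (w b + w b)
  swap
  · exact AddCon.exists_var_add_left (h2 b b hb hb sbb) _
  -- It suffices to replace `x_b ^ 2`, or `x_a x_b`, so that a non-special pair appears.
  have replace_sq : ∀ i j, e < w i → e < w j → w i + w j = w b + w b →
      ¬ IsSpecial e n (w a + w i) →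
      ∃ v, c (single a 1 + (single b 1 + single b 1)) (single z 1 + v) := by
    intro i j hi hj hij hai
    obtain ⟨v, hv⟩ := AddCon.exists_var_add_left (h2 a i ha hi hai) (single j 1)
    refine ⟨v, c.trans (c.add (c.refl _) (hs b b i j hb hb hi hj sbb hij)) ?_⟩
    rwa [← add_assoc, add_comm]
  by_cases hbb : w b + w b = 2 * e + 4
  · have hn : n = 4 := by
      have := h.bounds b
      unfold IsSpecial at sbb
      omega
    by_cases hab : a = b
    · subst hab
      simpa only [add_assoc] using h3 hn a (by omega)
    -- Here `x_a = x_{2e-1}`, and `x_a x_b` may be replaced by `x_{e+3} x_{2e-2}`.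
    have hab' : w a ≠ w b := fun h' => hab (h.inj h')
    obtain ⟨i, hi⟩ := h.exists_var (a := e + 3) (by omega) (by omega) (by omega) (by omega)
    obtain ⟨j, hj⟩ := h.exists_var (a := 2 * e - 2) (by omega) (by omega) (by omega) (by omega)
    unfold IsSpecial at sab
    obtain ⟨v, hv⟩ := AddCon.exists_var_add_left
      (h2 b i hb (by omega) (by unfold IsSpecial; omega)) (single j 1)
    refine ⟨v, ?_⟩
    rw [← add_assoc]
    refine c.trans (c.add (hs a b i j ha hb (by omega) (by omega) sab (by omega)) (c.refl _)) ?_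
    rwa [add_comm (single b 1), ← add_assoc, add_comm (single j 1)] at hv
  · obtain ⟨i, j, hi, hj, hij, hne⟩ := h.exists_pair_of_isSpecial sbb
    have hne := hne hbb
    by_cases sai : IsSpecial e n (w a + w i)
    swap
    · exact replace_sq i j hi hj hij sai
    refine replace_sq j i hj hi (by omega) ?_
    unfold IsSpecial at *
    omega

include h2 hs h3 in
theorem exists_congr_var_add_of_cubic {a b d : σ} (ha : e < w a) (hb : e < w b) (hd : e < w d) :
    ∃ v, c (single a 1 + single b 1 + single d 1) (single z 1 + v) := by
  have := h.two_le
  have := h.le_sub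
  by_cases sab : IsSpecial e n (w a + w b)
  swap
  · rw [add_comm _ (single d 1)]
    exact AddCon.exists_var_add_left (h2 a b ha hb sab) _
  by_cases sad : IsSpecial e n (w a + w d)
  swap
  · rw [add_right_comm, add_comm _ (single b 1)]
    exact AddCon.exists_var_add_left (h2 a d ha hd sad) _
  by_cases sbd : IsSpecial e n (w b + w d)
  swap
  · rw [add_assoc]
    exact AddCon.exists_var_add_left (h2 b d hb hd sbd) _
  -- There are only two special weights, so two of the three variables coincide.
  have heq : w a = w b ∨ w a = w d ∨ w b = w d := by
    unfold IsSpecial at *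
    omega
  rcases heq with heq | heq | heq <;> obtain rfl := h.inj heq
  · rw [add_comm]
    exact h.exists_congr_var_add_of_sq h2 hs h3 hd ha
  · rw [add_right_comm, add_comm]
    exact h.exists_congr_var_add_of_sq h2 hs h3 hb ha
  · rw [add_assoc]
    exact h.exists_congr_var_add_of_sq h2 hs h3 ha hb

include h2 hs h3 in
/-- Up to congruence, an exponent avoiding `z` is `0`, a variable, or a pair of special weight. -/
theorem exists_congr_var_add_or (hz : w z = e) (u : σ →₀ ℕ) :
    (∃ v, c u (single z 1 + v)) ∨ u = 0 ∨ (∃ a, u = single a 1) ∨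
      ∃ a b, e < w a ∧ e < w b ∧ IsSpecial e n (w a + w b) ∧ u = single a 1 + single b 1 := by
  by_cases huz : ∃ v, u = single z 1 + v
  · obtain ⟨v, rfl⟩ := huz
    exact Or.inl ⟨v, c.refl _⟩
  have hgt : ∀ a v, u = single a 1 + v → e < w a := by
    rintro a v rfl
    refine lt_of_le_of_ne (h.bounds a).1 fun hae => huz ?_
    exact ⟨v, by rw [h.inj (hae.symm.trans hz.symm)]⟩
  obtain rfl | ⟨a, rfl⟩ | ⟨a, b, rfl⟩ | ⟨a, b, d, v, rfl⟩ := exponent_cases u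
  · exact Or.inr (Or.inl rfl)
  · exact Or.inr (Or.inr (Or.inl ⟨a, rfl⟩))
  · have ha := hgt a _ rfl
    have hb := hgt b _ (add_comm _ _)
    by_cases sab : IsSpecial e n (w a + w b)
    · exact Or.inr (Or.inr (Or.inr ⟨a, b, ha, hb, sab, rfl⟩))
    · exact Or.inl (h2 a b ha hb sab)
  · left
    rw [add_comm]
    refine AddCon.exists_var_add_left (h.exists_congr_var_add_of_cubic h2 hs h3
      (hgt a (single b 1 + single d 1 + v) ?_) (hgt b (single a 1 + single d 1 + v) ?_)
      (hgt d (single a 1 + single b 1 + v) ?_)) v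
    all_goals abel

include h2 hs h3 in
theorem congr_of_weight_eq (hz : w z = e)
    (hc : ∀ u v, c u v → Finsupp.weight w u = Finsupp.weight w v) (u v : σ →₀ ℕ)
    (huv : Finsupp.weight w u = Finsupp.weight w v) : c u v := by
  have := h.ten_le
  induction hd : Finsupp.weight w u using Nat.strong_induction_on generalizing u v with
  | _ d ih =>
    have wadd : ∀ t : σ →₀ ℕ, Finsupp.weight w (single z 1 + t) = e + Finsupp.weight w t :=
      fun t => by rw [map_add, weight_var, hz]
    -- A weight with a factorization of one of the last three kinds has none divisible by `z`,
    -- and all its factorizations are congruent.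
    have low : ∀ u v : σ →₀ ℕ, Finsupp.weight w u = Finsupp.weight w v →
        (u = 0 ∨ (∃ a, u = single a 1) ∨
          ∃ a b, e < w a ∧ e < w b ∧ IsSpecial e n (w a + w b) ∧ u = single a 1 + single b 1) →
        c u v := by
      intro u v huv hu
      rcases hu with rfl | ⟨a, rfl⟩ | ⟨a, b, ha, hb, sab, rfl⟩
      · rw [h.eq_zero_of_weight (huv.symm.trans (map_zero _))]
        exact c.refl _
      · rw [h.eq_var_of_weight (huv.symm.trans (weight_var w a))]
        exact c.refl _
      · have hab : Finsupp.weight w v = w a + w b := by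
          rw [← huv, map_add, weight_var, weight_var]
        rcases h.exists_congr_var_add_or h2 hs h3 hz v with
          ⟨t, ht⟩ | rfl | ⟨i, rfl⟩ | ⟨i, j, hi, hj, -, rfl⟩
        · refine absurd sab ?_
          rw [← hab, hc _ _ ht, wadd]
          exact h.not_isSpecial_add t
        · rw [map_zero] at hab
          omega
        · have := h.bounds i
          rw [weight_var] at hab
          omega
        · rw [map_add, weight_var, weight_var] at hab
          exact hs a b i j ha hb hi hj sab hab
    rcases h.exists_congr_var_add_or h2 hs h3 hz u with ⟨u', hu'⟩ | hu
    swap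
    · exact low u v huv hu
    rcases h.exists_congr_var_add_or h2 hs h3 hz v with ⟨v', hv'⟩ | hv
    swap
    · exact c.symm (low v u huv.symm hv)
    have hwu := hc _ _ hu'
    have hwv := hc _ _ hv'
    rw [wadd] at hwu hwv
    exact c.trans hu' (c.trans
      (c.add (c.refl _) (ih (Finsupp.weight w u') (by omega) u' v' (by omega) rfl)) (c.symm hv'))

end Congruence

end IsSallyWeight

end SallyWeights

/-! ### The minimal binomials -/

section Count

open Finsupp

variable {σ : Type*} {w : σ → ℕ} {e n : ℕ}

/-- The exponent of the quadratic monomial `x_a x_b`. -/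
noncomputable def quadExponent : Sym2 σ → σ →₀ ℕ :=
  Sym2.lift ⟨fun a b => single a 1 + single b 1, fun _ _ => add_comm _ _⟩

@[simp]
theorem quadExponent_mk (a b : σ) : quadExponent s(a, b) = single a 1 + single b 1 := rfl

theorem quadExponent_injective : Function.Injective (quadExponent (σ := σ)) := by
  intro p q
  induction p with | _ a b
  induction q with | _ c d
  intro hpq
  simp only [quadExponent_mk] at hpq
  rw [Finsupp.single_add_single_eq_single_add_single one_ne_zero one_ne_zero] at hpq
  rw [Sym2.eq_iff]
  simpa using hpq

namespace IsSallyWeight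

variable (h : IsSallyWeight w e n)
include h

theorem exists_card_eq : ∃ J : Finset σ, (∀ i, i ∈ J ↔ e < w i) ∧ J.card = e - 3 := by
  classical
  have := h.ten_le
  have := h.two_le
  have := h.le_sub
  let B : Finset ℕ := (Finset.Icc (e + 2) (2 * e - 1)).erase (e + n)
  have hB : ∀ a, a ∈ B ↔ a ≠ e + n ∧ e + 2 ≤ a ∧ a ≤ 2 * e - 1 := fun a => by simp [B]
  have hmem : ∀ i, i ∈ B.preimage w h.inj.injOn ↔ e < w i := fun i => by
    have := h.bounds i
    rw [Finset.mem_preimage, hB]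
    omega
  refine ⟨B.preimage w h.inj.injOn, hmem, ?_⟩
  have himage : (B.preimage w h.inj.injOn).image w = B := by
    ext a
    simp only [Finset.mem_image, hmem]
    constructor
    · rintro ⟨i, hi, rfl⟩
      have := h.bounds i
      rw [hB]
      omega
    · intro ha
      rw [hB] at ha
      obtain ⟨i, rfl⟩ := h.exists_var (a := a) (by omega) (by omega) (by omega) (by omega)
      exact ⟨i, by omega, rfl⟩
  rw [← Finset.card_image_of_injective _ h.inj, himage, Finset.card_erase_of_mem (by
    rw [Finset.mem_Icc]; omega), Nat.card_Icc]
  omega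

/-- A proper divisor of a quadratic monomial, or of `x_{e+2} ^ 3` when `n = 4`, is the only monomial
of its weight. -/
theorem eq_of_weight_eq_of_proper {m u v v' : σ →₀ ℕ}
    (hm : (∃ a b, m = single a 1 + single b 1) ∨
      n = 4 ∧ ∃ a, w a = e + 2 ∧ m = single a 1 + single a 1 + single a 1)
    (huv : u + v = m) (hu : u ≠ 0) (hv' : Finsupp.weight w v' = Finsupp.weight w v) :
    v' = v := by
  have hdeg := congrArg Finsupp.degree huv
  obtain rfl | ⟨i, u, rfl⟩ := exists_eq_var_add u
  · exact absurd rfl hu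
  obtain rfl | ⟨j, rfl⟩ | ⟨j, k, rfl⟩ | ⟨j, k, l, v, rfl⟩ := exponent_cases v
  · exact h.eq_zero_of_weight (hv'.trans (map_zero _))
  · exact h.eq_var_of_weight (hv'.trans (weight_var w j))
  · rcases hm with ⟨a, b, rfl⟩ | ⟨hn, a, ha, rfl⟩
    · simp only [map_add, Finsupp.degree_single] at hdeg
      omega
    · have hmem : ∀ t, 0 < (single j 1 + single k 1 : σ →₀ ℕ) t → t = a := by
        intro t ht
        by_contra hta
        have := DFunLike.congr_fun huv t
        have hat : (single a 1 : σ →₀ ℕ) t = 0 := Finsupp.single_eq_of_ne hta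
        simp only [Finsupp.add_apply, hat] at this ht
        omega
      obtain rfl := hmem j (by simp)
      obtain rfl := hmem k (by simp)
      exact h.eq_sq_of_weight hn ha (by rw [hv', map_add, weight_var])
  · rcases hm with ⟨a, b, rfl⟩ | ⟨hn, a, ha, rfl⟩ <;>
    · simp only [map_add, Finsupp.degree_single] at hdeg
      omega

/-- The minimal generators are indexed by the quadratic monomials not divisible by the variable of
weight `e`, apart from one monomial for each of the two special weights, and, for `n = 4`, by
`x_{e+2} ^ 3`. -/
theorem spanRank_toricIdeal (K : Type*) [Field K] :
    (toricIdeal K w).spanRank =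
      ((if n = 4 then (e - 2).choose 2 - 1 else (e - 2).choose 2 - 2 : ℕ) : Cardinal) := by
  classical
  have he := h.ten_le
  have hn2 := h.two_le
  have hne := h.le_sub
  obtain ⟨J, hJ, hJcard⟩ := h.exists_card_eq
  obtain ⟨z, hz⟩ := h.exists_var (a := e) (by omega) (by omega) (by omega) (by omega)
  obtain ⟨d, hd, hd'⟩ : ∃ d, IsSpecial e n d ∧ d ≠ 3 * e + 1 := by
    by_cases hn : n < 4
    · exact ⟨3 * e + n, Or.inr (Or.inl ⟨hn, rfl⟩), by omega⟩
    · exact ⟨2 * e + n, Or.inr (Or.inr ⟨by omega, rfl⟩), by omega⟩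
  have hspecial : ∀ d', IsSpecial e n d' ↔ d' = 3 * e + 1 ∨ d' = d := by
    intro d'
    unfold IsSpecial at *
    omega
  obtain ⟨p₁, p₂, hp₁, hp₂, hp, -⟩ := h.exists_pair_of_isSpecial (d := 3 * e + 1) (Or.inl rfl)
  obtain ⟨q₁, q₂, hq₁, hq₂, hq, -⟩ := h.exists_pair_of_isSpecial hd
  have hwp : Finsupp.weight w (quadExponent s(p₁, p₂)) = 3 * e + 1 := by simp [weight_var, hp]
  have hwq : Finsupp.weight w (quadExponent s(q₁, q₂)) = d := by simp [weight_var, hq]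
  have hpq : s(p₁, p₂) ≠ s(q₁, q₂) := fun heq => hd' (by rw [← hwq, ← heq, hwp])
  obtain ⟨y, hy⟩ : ∃ y, n = 4 → w y = e + 2 := by
    by_cases hn : n = 4
    · obtain ⟨y, hy⟩ := h.exists_var (a := e + 2) (by omega) (by omega) (by omega) (by omega)
      exact ⟨y, fun _ => hy⟩
    · exact ⟨z, fun h' => absurd h' hn⟩
  let T₂ : Finset (σ →₀ ℕ) := ((J.sym2.erase s(p₁, p₂)).erase s(q₁, q₂)).image quadExponent
  let y₃ : σ →₀ ℕ := single y 1 + single y 1 + single y 1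
  let T : Finset (σ →₀ ℕ) := if n = 4 then insert y₃ T₂ else T₂
  have hT₂card : T₂.card = (e - 2).choose 2 - 2 := by
    rw [Finset.card_image_of_injective _ quadExponent_injective, Finset.card_erase_of_mem,
      Finset.card_erase_of_mem, Finset.card_sym2, hJcard, show e - 3 + 1 = e - 2 by omega]
    · omega
    · simp [hJ, hp₁, hp₂]
    · simp [hJ, hq₁, hq₂, hpq.symm]
  have hmemT₂ : ∀ m, m ∈ T₂ ↔ ∃ a b, e < w a ∧ e < w b ∧ m = single a 1 + single b 1 ∧
      m ≠ quadExponent s(p₁, p₂) ∧ m ≠ quadExponent s(q₁, q₂) := by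
    intro m
    simp only [T₂, Finset.mem_image, Finset.mem_erase]
    constructor
    · rintro ⟨s, ⟨hs1, hs2, hs3⟩, rfl⟩
      induction s with | _ a b
      rw [Finset.mk_mem_sym2_iff, hJ, hJ] at hs3
      exact ⟨a, b, hs3.1, hs3.2, rfl, quadExponent_injective.ne hs2,
        quadExponent_injective.ne hs1⟩
    · rintro ⟨a, b, ha, hb, rfl, h1, h2⟩
      refine ⟨s(a, b), ⟨fun h' => h2 (by rw [← h']; rfl), fun h' => h1 (by rw [← h']; rfl), ?_⟩,
        rfl⟩
      rw [Finset.mk_mem_sym2_iff, hJ, hJ]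
      exact ⟨ha, hb⟩
  have hmemT : ∀ m, m ∈ T ↔ m ∈ T₂ ∨ n = 4 ∧ m = y₃ := by
    intro m
    by_cases hn : n = 4 <;> simp [T, hn, or_comm]
  have hdeg₂ : ∀ m ∈ T₂, Finsupp.degree m = 2 := by
    intro m hm
    obtain ⟨a, b, -, -, rfl, -⟩ := (hmemT₂ m).1 hm
    simp
  have hdeg₃ : Finsupp.degree y₃ = 3 := by simp [y₃]
  have hTcard : T.card = if n = 4 then (e - 2).choose 2 - 1 else (e - 2).choose 2 - 2 := by
    have hy₃ : y₃ ∉ T₂ := fun h' => by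
      have := hdeg₂ _ h'
      omega
    have hchoose : 2 ≤ (e - 2).choose 2 :=
      le_trans (by decide) (Nat.choose_le_choose 2 (show 8 ≤ e - 2 by omega))
    by_cases hn : n = 4
    · simp only [T, if_pos hn, Finset.card_insert_of_notMem hy₃, hT₂card]
      omega
    · simp only [T, if_neg hn, hT₂card]
  have hTz : ∀ v, single z 1 + v ∉ T := by
    intro v hv
    have hval : 0 < (single z 1 + v : σ →₀ ℕ) z := by simp
    rcases (hmemT _).1 hv with hv | ⟨hn, hv⟩
    · obtain ⟨a, b, ha, hb, hab, -⟩ := (hmemT₂ _).1 hv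
      have ha' : a ≠ z := by rintro rfl; omega
      have hb' : b ≠ z := by rintro rfl; omega
      rw [hab] at hval
      simp [ha', hb'] at hval
    · have hy' : y ≠ z := by rintro rfl; have := hy hn; omega
      rw [hv] at hval
      simp [y₃, hy'] at hval
  have hTp : quadExponent s(p₁, p₂) ∉ T := by
    intro hv
    rcases (hmemT _).1 hv with hv | ⟨hn, hv⟩
    · obtain ⟨a, b, -, -, -, h1, -⟩ := (hmemT₂ _).1 hv
      exact h1 rfl
    · have := congrArg Finsupp.degree hv
      simp [hdeg₃] at this
  have hTq : quadExponent s(q₁, q₂) ∉ T := by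
    intro hv
    rcases (hmemT _).1 hv with hv | ⟨hn, hv⟩
    · obtain ⟨a, b, -, -, -, -, h2⟩ := (hmemT₂ _).1 hv
      exact h2 rfl
    · have := congrArg Finsupp.degree hv
      simp [hdeg₃] at this
  have hex : ∀ m, ∃ v, m ∈ T → Finsupp.weight w v = Finsupp.weight w m ∧
      ((∃ t, v = single z 1 + t) ∨ v = quadExponent s(p₁, p₂) ∨ v = quadExponent s(q₁, q₂)) := by
    intro m
    by_cases hm : m ∈ T
    swap
    · exact ⟨0, fun h' => absurd h' hm⟩
    rcases (hmemT m).1 hm with hm | ⟨hn, rfl⟩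
    · obtain ⟨a, b, ha, hb, rfl, -⟩ := (hmemT₂ m).1 hm
      have ha' := h.bounds a
      have hb' := h.bounds b
      have hwm : Finsupp.weight w (single a 1 + single b 1) = w a + w b := by
        rw [map_add, weight_var, weight_var]
      rw [hwm]
      by_cases sab : IsSpecial e n (w a + w b)
      · rcases (hspecial _).1 sab with hab | hab
        · exact ⟨_, fun _ => ⟨hwp.trans hab.symm, Or.inr (Or.inl rfl)⟩⟩
        · exact ⟨_, fun _ => ⟨hwq.trans hab.symm, Or.inr (Or.inr rfl)⟩⟩
      · obtain ⟨u, hu⟩ := h.exists_weight_add_eq (by omega) (by omega) sab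
        exact ⟨single z 1 + u, fun _ => ⟨by rw [map_add, weight_var, hz, hu], Or.inl ⟨u, rfl⟩⟩⟩
    · -- `x_{e+2} ^ 3` and `x_e ^ 2 x_{e+6}` have equal weight.
      have hy := hy hn
      obtain ⟨i, hi⟩ := h.exists_var (a := e + 6) (by omega) (by omega) (by omega) (by omega)
      refine ⟨single z 1 + (single z 1 + single i 1), fun _ => ⟨?_, Or.inl ⟨_, rfl⟩⟩⟩
      simp only [y₃, map_add, weight_var, hz, hi, hy]
      omega
  choose nf hnf using hex
  rw [← hTcard]
  refine _root_.spanRank_toricIdeal T nf ?_ (fun m hm => (hnf m hm).1) ?_ ?_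
  · intro m hm
    rcases (hnf m hm).2 with ⟨t, ht⟩ | ht | ht <;> rw [ht]
    exacts [hTz t, hTp, hTq]
  · intro m hm u v huv hu v' hv'
    refine h.eq_of_weight_eq_of_proper ?_ huv hu hv'
    rcases (hmemT m).1 hm with hm | ⟨hn, rfl⟩
    · obtain ⟨a, b, -, -, hab, -⟩ := (hmemT₂ m).1 hm
      exact Or.inl ⟨a, b, hab⟩
    · exact Or.inr ⟨hn, y, hy hn, rfl⟩
  · set c := addConGen fun m m' => m ∈ T ∧ m' = nf m with hc
    have hcnf : ∀ m ∈ T, c m (nf m) := fun m hm => AddConGen.Rel.of _ _ ⟨hm, rfl⟩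
    have hcw : ∀ u v, c u v → Finsupp.weight w u = Finsupp.weight w v := by
      have hle : c ≤ AddCon.ker (Finsupp.weight w) := by
        rw [hc, AddCon.addConGen_le]
        rintro m _ ⟨hm, rfl⟩
        exact (hnf m hm).1.symm
      exact fun u v huv => hle huv
    -- A pair of special weight is congruent to the chosen pair of the same weight.
    have hcs : ∀ a b, e < w a → e < w b → IsSpecial e n (w a + w b) →
        c (single a 1 + single b 1)
          (if w a + w b = 3 * e + 1 then quadExponent s(p₁, p₂) else quadExponent s(q₁, q₂)) := by
      intro a b ha hb sab
      have hwab : Finsupp.weight w (single a 1 + single b 1) = w a + w b := by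
        rw [map_add, weight_var, weight_var]
      by_cases h1 : single a 1 + single b 1 = quadExponent s(p₁, p₂)
      · rw [h1, hwp] at hwab
        rw [h1, if_pos hwab.symm]
        exact c.refl _
      by_cases h2 : single a 1 + single b 1 = quadExponent s(q₁, q₂)
      · rw [h2, hwq] at hwab
        rw [h2, if_neg (by omega)]
        exact c.refl _
      have hm : single a 1 + single b 1 ∈ T :=
        (hmemT _).2 (Or.inl ((hmemT₂ _).2 ⟨a, b, ha, hb, rfl, h1, h2⟩))
      have hcm := hcnf _ hm
      obtain ⟨hw, ⟨t, ht⟩ | ht | ht⟩ := hnf _ hm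
      · rw [ht, hwab, map_add, weight_var, hz] at hw
        exact absurd (hw ▸ sab) (h.not_isSpecial_add t)
      · rw [ht, hwp, hwab] at hw
        rwa [if_pos hw.symm, ← ht]
      · rw [ht, hwq, hwab] at hw
        rwa [if_neg (by omega), ← ht]
    refine h.congr_of_weight_eq (z := z) ?_ ?_ ?_ hz hcw
    · intro a b ha hb sab
      have hwab : Finsupp.weight w (single a 1 + single b 1) = w a + w b := by
        rw [map_add, weight_var, weight_var]
      rw [hspecial, ← hwab] at sab
      have hm : single a 1 + single b 1 ∈ T := by
        refine (hmemT _).2 (Or.inl ((hmemT₂ _).2 ⟨a, b, ha, hb, rfl, ?_, ?_⟩)) <;> intro heq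
        · exact sab (Or.inl (by rw [heq, hwp]))
        · exact sab (Or.inr (by rw [heq, hwq]))
      obtain ⟨hw, ⟨t, ht⟩ | ht | ht⟩ := hnf _ hm
      · exact ⟨t, ht ▸ hcnf _ hm⟩
      · exact absurd (Or.inl (by rw [← hw, ht, hwp])) sab
      · exact absurd (Or.inr (by rw [← hw, ht, hwq])) sab
    · intro a b i j ha hb hi hj sab hij
      have h1 := hcs a b ha hb sab
      have h2 := hcs i j hi hj (hij ▸ sab)
      rw [hij] at h2
      exact c.trans h1 (c.symm h2)
    · intro hn a ha
      obtain rfl : a = y := h.inj (by rw [ha, hy hn])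
      have hm : y₃ ∈ T := (hmemT _).2 (Or.inr ⟨hn, rfl⟩)
      have hwy : Finsupp.weight w y₃ = 3 * e + 6 := by
        simp only [y₃, map_add, weight_var, ha]
        omega
      obtain ⟨hw, ⟨t, ht⟩ | ht | ht⟩ := hnf _ hm
      · exact ⟨t, ht ▸ hcnf _ hm⟩
      · rw [ht, hwp, hwy] at hw
        omega
      · rw [ht, hwq, hwy] at hw
        unfold IsSpecial at hd
        omega

end IsSallyWeight

end Count

/-! ### The semigroup `S(e,1,n)` -/

/-- A subset of `[e, 2e)` consists of minimal generators of the monoid that it generates. -/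
theorem minimalGenerators_closure {A : Set ℕ} {e : ℕ}
    (hA : ∀ a ∈ A, e ≤ a ∧ a < 2 * e) : minimalGenerators (AddSubmonoid.closure A) = A := by
  apply subset_antisymm
  · exact (isLeast_minimalGenerators _).2 rfl
  · intro a ha
    have hge : ∀ b ∈ AddSubmonoid.closure A, b = 0 ∨ e ≤ b := by
      intro b hb
      induction hb using AddSubmonoid.closure_induction with
      | mem x hx => exact Or.inr (hA x hx).1
      | zero => exact Or.inl rfl
      | add x y _ _ hx hy => omega
    have := hA a ha
    refine ⟨AddSubmonoid.subset_closure ha, by omega, fun b hb c hc habc => ?_⟩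
    have := hge b hb
    have := hge c hc
    omega

theorem minimalGenerators_sallyTypeSemigroup {e m n : ℕ} (he : 0 < e) :
    minimalGenerators (sallyTypeSemigroup e m n) =
      Set.Icc e (2 * e - 1) \ {e + m, e + n} := by
  refine minimalGenerators_closure (e := e) fun a ha => ?_
  have := ha.1
  rw [Set.mem_Icc] at this
  omega

theorem isSallyWeight_minimalGenerators {e n : ℕ} (he : 10 ≤ e) (hn : 2 ≤ n) (hne : n ≤ e - 2) :
    IsSallyWeight (Subtype.val : minimalGenerators (sallyTypeSemigroup e 1 n) → ℕ) e n where
  ten_le := he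
  two_le := hn
  le_sub := hne
  inj := Subtype.val_injective
  range a := by
    simp only [Subtype.exists, exists_prop, exists_eq_right,
      minimalGenerators_sallyTypeSemigroup (show 0 < e by omega), Set.mem_sdiff, Set.mem_Icc,
      Set.mem_insert_iff, Set.mem_singleton_iff]
    omega

theorem semigroupWidth_sallyTypeSemigroup {e n : ℕ} (he : 10 ≤ e) (hn : 2 ≤ n) (hne : n ≤ e - 2) :
    semigroupWidth (sallyTypeSemigroup e 1 n) = e - 1 := by
  have hmem : ∀ a, a ∈ minimalGenerators (sallyTypeSemigroup e 1 n) ↔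
      (e ≤ a ∧ a ≤ 2 * e - 1) ∧ ¬(a = e + 1 ∨ a = e + n) := by
    intro a
    rw [minimalGenerators_sallyTypeSemigroup (by omega)]
    rfl
  have hmax : IsGreatest (minimalGenerators (sallyTypeSemigroup e 1 n)) (2 * e - 1) :=
    ⟨by rw [hmem]; omega, fun a ha => by rw [hmem] at ha; omega⟩
  have hmin : IsLeast (minimalGenerators (sallyTypeSemigroup e 1 n)) e :=
    ⟨by rw [hmem]; omega, fun a ha => by rw [hmem] at ha; omega⟩
  rw [semigroupWidth, hmax.csSup_eq, hmin.csInf_eq]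
  omega

theorem mainTheorem8 (K : Type*) [Field K] (e n : ℕ) (he : 10 ≤ e) (hn : 2 ≤ n)
    (hne : n ≤ e - 2) :
    (definingIdeal K (sallyTypeSemigroup e 1 n)).spanRank =
        ((if n = 4 then (e - 2).choose 2 - 1 else (e - 2).choose 2 - 2 : ℕ) : Cardinal) ∧
      (definingIdeal K (sallyTypeSemigroup e 1 n)).spanRank ≤
        (((semigroupWidth (sallyTypeSemigroup e 1 n) + 1).choose 2 : ℕ) : Cardinal) := by
  have hrank : (definingIdeal K (sallyTypeSemigroup e 1 n)).spanRank =
      ((if n = 4 then (e - 2).choose 2 - 1 else (e - 2).choose 2 - 2 : ℕ) : Cardinal) :=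
    (isSallyWeight_minimalGenerators he hn hne).spanRank_toricIdeal K
  refine ⟨hrank, ?_⟩
  rw [hrank, semigroupWidth_sallyTypeSemigroup he hn hne, Nat.cast_le]
  have hle := Nat.choose_le_choose 2 (show e - 2 ≤ e - 1 + 1 by omega)
  split_ifs <;> omega
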